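/- Order $\mathbb{N}^2$ componentwise, and let $\min(\alpha,\beta)$ be the componentwise minimum. A submonoid $S$ of $(\mathbb{N}^2,+)$ is a *good semigroup* if (G1) $\min(\alpha,\beta)\in S$ for all $\alpha,\beta\in S$; (G2) $\delta+\mathbb{N}^2\subseteq S$ for some $\delta\in\mathbb{N}^2$; (G3) whenever $\alpha\neq\beta$ in $S$ satisfy $\alpha_i=\beta_i$, there is $\epsilon\in S$ with $\epsilon_i>\alpha_i$ and $\epsilon_j\ge\min(\alpha_j,\beta_j)$ for $j\neq i$, with equality if $\alpha_j\ne\beta_j$. It is *local* if $0$ is its only element with a zero component. Let $c(S)$ be the conductor of $S$, i.e. the minimum of all $\delta$ with $\delta+\mathbb{N}^2\subseteq S$, and let $C(S)=\{\beta\in S:\beta\ge c(S)\}$. For $E\in\{\mathbb{N}^2,S,C(S)\}$ and $\alpha\le\beta$ in $E$, let $d_E(\alpha,\beta)$ be the common length of the saturated chains from $\alpha$ to $\beta$ in $E$. For $E\supseteq F$ let $d(E\setminus F)=d_E(\min E,\alpha)-d_F(\min F,\alpha)$ for $\alpha$ large enough (this is independent of $\alpha$). The *genus* is $g(S)=d(\mathbb{N}^2\setminus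 S)$ and the *length* is $l(S)=d(S\setminus C(S))$. Let $A\subseteq\mathbb{N}^2$ be a set whose complement contains some $c+\mathbb{N}^2$. Define inductively, for $i\geq 1$: $B^{(i)}$ is the set of those $\alpha\in A\setminus\bigcup_{j<i}D^{(j)}$ for which no $\beta$ in the same set satisfies $\alpha_1<\beta_1$ and $\alpha_2<\beta_2$; and $D^{(i)}$ is $B^{(i)}$ without those $\alpha$ that equal $\min(\beta,\beta')$ for some $\beta,\beta'\in B^{(i)}\setminus\{\alpha\}$. Then $A=D^{(1)}\cup\dots\cup D^{(N)}$ for some $N$; the least such $N$ is the number of levels $\operatorname{NL}(A)$. The *type* of $S$ is $t(S)=\operatorname{NL}(\operatorname{PF}(S))$, where $\operatorname{PF}(S)=\{\alpha\in\mathbb{N}^2\setminus S:\alpha+M\subseteq S\}$ and $M=S\setminus\{0\}$. **Corollary.** For every local good semigroup $S\subseteq\mathbb{N}^2$, $$g(S)\ \ge\ t(S)+l(S)-1 .$$ (It is not assumed that $S-M=\{\alpha\in\mathbb{Z}^2:\alpha+M\subseteq S\}$ is a good ideal of $S$.) -/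

import Mathlib

/-! Vectors of `ℕ^d` are functions `Fin d → ℕ`, with the componentwise order `≤` and the
componentwise minimum `⊓`. -/

namespace GoodSemigroup

/-- A submonoid `S` of `ℕ^d` is a good semigroup if it satisfies (G1), (G2) and (G3). -/
structure IsGood {d : ℕ} (S : AddSubmonoid (Fin d → ℕ)) : Prop where
  /-- (G1): closed under componentwise minima. -/
  inf_mem : ∀ α ∈ S, ∀ β ∈ S, α ⊓ β ∈ S
  /-- (G2): contains some `δ + ℕ^d`. -/
  exists_conductor : ∃ δ : Fin d → ℕ, ∀ β, δ + β ∈ S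
  /-- (G3). -/
  exchange : ∀ α ∈ S, ∀ β ∈ S, α ≠ β → ∀ i, α i = β i →
    ∃ ε ∈ S, α i < ε i ∧
      ∀ j, j ≠ i → min (α j) (β j) ≤ ε j ∧ (α j ≠ β j → ε j = min (α j) (β j))

/-- `S` is local if its only element with a zero component is `0`. -/
def IsLocal {d : ℕ} (S : AddSubmonoid (Fin d → ℕ)) : Prop :=
  ∀ α ∈ S, (∃ i, α i = 0) → α = 0

/-- The conductor `c(E)`: the minimum of the vectors `δ` such that all `β ≥ δ` lie in `E`
(taken as a componentwise
infimum, which is attained as soon as `E` is closed under componentwise minima and the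
set of these `δ` is not empty). -/
noncomputable def conductor {d : ℕ} (E : Set (Fin d → ℕ)) : Fin d → ℕ :=
  sInf {δ | ∀ β, δ ≤ β → β ∈ E}

/-- The conductor ideal `C(E)`, the set of the elements of `E` that are `≥ c(E)`. -/
def conductorIdeal {d : ℕ} (E : Set (Fin d → ℕ)) : Set (Fin d → ℕ) :=
  {β ∈ E | conductor E ≤ β}

/-- There is a saturated chain `α = a 0 < a 1 < ⋯ < a n = β` of length `n` in `E`:
no element of `E` lies strictly between two successive terms. -/
def HasSaturatedChain {d : ℕ} (E : Set (Fin d → ℕ)) (α β : Fin d → ℕ) (n : ℕ) : Prop :=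
  ∃ a : ℕ → (Fin d → ℕ), a 0 = α ∧ a n = β ∧ (∀ k ≤ n, a k ∈ E) ∧
    ∀ k < n, a k < a (k + 1) ∧ ∀ γ ∈ E, ¬ (a k < γ ∧ γ < a (k + 1))

/-- `d_E(α, β)`: the length of the saturated chains from `α` to `β` in `E` (in a good
relative ideal all of them have the same length, and there is at least one when
`α ≤ β` are in `E`). -/
noncomputable def chainDist {d : ℕ} (E : Set (Fin d → ℕ)) (α β : Fin d → ℕ) : ℕ :=
  sInf {n | HasSaturatedChain E α β n}

/-- `d(E ∖ F) = d_E(e(E), α) - d_F(e(F), α)` for `E ⊇ F`, where `e(E) = min E` and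
`e(F) = min F` (the componentwise infima) and `α` is large. The difference does not
depend on `α` as long as everything above `α` is in `E` and `F`; the value used
is `α = c(F)`. -/
noncomputable def idealDist {d : ℕ} (E F : Set (Fin d → ℕ)) : ℤ :=
  (chainDist E (sInf E) (conductor F) : ℤ) - (chainDist F (sInf F) (conductor F) : ℤ)

/-- The genus `g(S) = d(ℕ^d ∖ S)`. -/
noncomputable def genus {d : ℕ} (S : AddSubmonoid (Fin d → ℕ)) : ℤ :=
  idealDist Set.univ (S : Set (Fin d → ℕ))

/-- The length `l(S) = d(S ∖ C(S))`. -/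
noncomputable def length {d : ℕ} (S : AddSubmonoid (Fin d → ℕ)) : ℤ :=
  idealDist (S : Set (Fin d → ℕ)) (conductorIdeal (S : Set (Fin d → ℕ)))

/-- The elements of `A ⊆ ℕ²` that are maximal with respect to `≤≤`, that is, that are
strictly smaller in both components than no element of `A`. -/
def maximals (A : Set (Fin 2 → ℕ)) : Set (Fin 2 → ℕ) :=
  {α ∈ A | ∀ β ∈ A, ¬ StrongLT α β}

/-- The top level of `A`: the set `B` of the maximal elements of `A`, without those that
are the componentwise minimum of two other elements of `B`. -/
def topLevel (A : Set (Fin 2 → ℕ)) : Set (Fin 2 → ℕ) :=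
  {α ∈ maximals A | ¬ ∃ β₁ ∈ maximals A \ {α}, ∃ β₂ ∈ maximals A \ {α}, α = β₁ ⊓ β₂}

/-- What remains of `A` after the removal of its first `n` levels from the top,
`A ∖ (D⁽¹⁾ ∪ ⋯ ∪ D⁽ⁿ⁾)` where `D⁽ⁱ⁺¹⁾ = topLevel (remaining A i)`. -/
def remaining (A : Set (Fin 2 → ℕ)) : ℕ → Set (Fin 2 → ℕ)
  | 0 => A
  | n + 1 => remaining A n \ topLevel (remaining A n)

/-- The number of levels `NL(A)` in the partition `A = D⁽¹⁾ ∪ ⋯ ∪ D⁽ᴺ⁾` into levels. -/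
noncomputable def numLevels (A : Set (Fin 2 → ℕ)) : ℕ :=
  sInf {N | remaining A N = ∅}

/-- The pseudo-Frobenius elements: the `α ∈ ℕ² ∖ S` such that `α + M ⊆ S`, where
`M = S ∖ {0}`. -/
def pseudoFrobenius (S : AddSubmonoid (Fin 2 → ℕ)) : Set (Fin 2 → ℕ) :=
  {α | α ∉ S ∧ ∀ β ∈ S, β ≠ 0 → α + β ∈ S}

/-- The type `t(S) = NL(PF(S))`. -/
noncomputable def type (S : AddSubmonoid (Fin 2 → ℕ)) : ℕ :=
  numLevels (pseudoFrobenius S)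

theorem strip_step {A : Set (Fin 2 → ℕ)} {c : Fin 2 → ℕ} (hA : ∀ β, c ≤ β → β ∉ A)
    (i j : Fin 2) (hij : ∀ k, k = i ∨ k = j) (n : ℕ) :
    ∀ α ∈ remaining A n, c j ≤ α j → α i + n < c i := by
  have hsub : ∀ n, remaining A n ⊆ A := by
    intro n
    induction n with
    | zero => exact subset_rfl
    | succ n ih => exact Set.sdiff_subset.trans ih
  induction n with
  | zero =>
    intro α hα hj
    by_contra hlt
    refine hA α (fun k => ?_) (hsub 0 hα)
    rcases hij k with rfl | rfl
    · exact not_lt.1 hlt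
    · exact hj
  | succ n ih =>
    intro α hα hj
    obtain ⟨hα, hnot⟩ := hα
    have h1 := ih α hα hj
    by_contra hlt
    refine hnot ⟨⟨hα, fun β hβ hab => ?_⟩, ?_⟩
    · have h2 := ih β hβ (hj.trans (hab j).le)
      have h3 : α i < β i := hab i
      omega
    · rintro ⟨β₁, ⟨hβ₁, hne₁⟩, β₂, ⟨hβ₂, hne₂⟩, hmin⟩
      have hi : α i = min (β₁ i) (β₂ i) := congrFun hmin i
      have hj' : α j = min (β₁ j) (β₂ j) := congrFun hmin j
      have h2 := ih β₁ hβ₁.1 (by omega)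
      have h3 := ih β₂ hβ₂.1 (by omega)
      have e1 : β₁ i = α i := by omega
      have e2 : β₂ i = α i := by omega
      rcases le_total (β₁ j) (β₂ j) with h | h
      · apply hne₁
        funext k
        rcases hij k with rfl | rfl
        · exact e1
        · omega
      · apply hne₂
        funext k
        rcases hij k with rfl | rfl
        · exact e2
        · omega

/-- The partition into levels is finite, so that `numLevels` is meaningful, for every `A`
whose complement contains some `c + ℕ²`. -/
theorem exists_remaining_eq_empty {A : Set (Fin 2 → ℕ)} {c : Fin 2 → ℕ}
    (hA : ∀ β, c ≤ β → β ∉ A) : ∃ N, remaining A N = ∅ := by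
  have hfin : (remaining A (c 0 + c 1)).Finite := by
    refine (Set.finite_Iic c).subset fun α hα k => ?_
    have h0 := strip_step hA 0 1 (by decide) _ α hα
    have h1 := strip_step hA 1 0 (by decide) _ α hα
    fin_cases k
    · change α 0 ≤ c 0
      by_contra h
      have := h1 (by omega)
      omega
    · change α 1 ≤ c 1
      by_contra h
      have := h0 (by omega)
      omega
  have key : ∀ m n, (remaining A n).Finite → (remaining A n).ncard ≤ m →
      ∃ N, remaining A N = ∅ := by
    intro m
    induction m with
    | zero => exact fun n hf hc => ⟨n, (Set.ncard_eq_zero hf).1 (by omega)⟩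
    | succ m ih =>
      intro n hf hc
      rcases Set.eq_empty_or_nonempty (remaining A n) with he | hne
      · exact ⟨n, he⟩
      obtain ⟨α, hα, hmax⟩ := hf.exists_maximalFor id _ hne
      have hle : ∀ β ∈ remaining A n, α ≤ β → β = α := fun β hβ h => le_antisymm (hmax hβ h) h
      have htop : α ∈ topLevel (remaining A n) := by
        refine ⟨⟨hα, fun β hβ hab => ?_⟩, ?_⟩
        · have := hle β hβ (fun k => (hab k).le)
          have h0 := hab 0
          rw [this] at h0
          exact lt_irrefl _ h0
        · rintro ⟨β₁, ⟨hβ₁, hne₁⟩, β₂, -, hmin⟩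
          exact hne₁ (hle β₁ hβ₁.1 (hmin ▸ inf_le_left))
      refine ih (n + 1) (hf.subset Set.sdiff_subset) ?_
      have : (remaining A (n + 1)).ncard < (remaining A n).ncard :=
        Set.ncard_lt_ncard ⟨Set.sdiff_subset, fun h => (h hα).2 htop⟩ hf
      omega
  exact key _ _ hfin le_rfl

end GoodSemigroup

namespace GoodSemigroup

/-! Distances in `S` can be computed on paths of unit steps in `ℕ²`: the step from `p` to `p + e i`
counts if `S` has a point above `p` with the same `i`-th coordinate. By (G3) the count `rank` does
not depend on the path.

Let `c` be the conductor. A step counts for the canonical ideal if the opposite step, reflected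
through `c`, does not count for `S`. So `excess` measures the distance from `S` to that ideal. It is
monotone (`excess_mono`), it vanishes at `0`, and its largest value, attained at `c`, is `c 0 + c 1
- 2 * rank S c`, which is at most `g(S) - l(S)` (`excess_conductor_le`).

It remains to bound the levels of `PF(S)` by the excess. From a pseudo-Frobenius element below the
top level, some unit step raises the excess (`exists_excess_lt`). An element of the preceding
remainder lies above the end of that step, so each level after the first costs at least one unit,
and `t(S) - 1` is at most the excess at `c`. -/

/-- The unit step `e i`. -/
abbrev unitStep (i : Fin 2) : Fin 2 → ℕ := Pi.single i 1

theorem monotone_of_le_add_unitStep {β : Type*} [Preorder β] {f : (Fin 2 → ℕ) → β}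
    (hf : ∀ p i, f p ≤ f (p + unitStep i)) : Monotone f := by
  have key : ∀ (i : Fin 2) (n : ℕ) p, f p ≤ f (p + Pi.single i n) := by
    intro i n
    induction n with
    | zero => intro p; simp
    | succ n ih =>
      intro p
      refine (ih p).trans ((hf _ i).trans_eq ?_)
      rw [add_assoc, ← Pi.single_add]
  intro p q hpq
  have hq : q = p + Pi.single 0 (q 0 - p 0) + Pi.single 1 (q 1 - p 1) := by
    funext k
    have := hpq k
    fin_cases k <;> simp at this ⊢ <;> omega
  rw [hq]
  exact (key _ _ _).trans (key _ _ _)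

/-! ### Step weights and the path-independent rank. -/

variable (S : AddSubmonoid (Fin 2 → ℕ))

/-- Some element of `S` lies above `p` on the line through `p` on which the `i`-th coordinate is
constant. -/
def MeetsLine (i : Fin 2) (p : Fin 2 → ℕ) : Prop :=
  ∃ s ∈ S, p ≤ s ∧ s i = p i

open Classical in
/-- The contribution `0` or `1` of the step from `p` to `p + e i` to distances in `S`. -/
noncomputable def stepWeight (i : Fin 2) (p : Fin 2 → ℕ) : ℕ :=
  if MeetsLine S i p then 1 else 0

/-- The number of the steps of positive weight on a path of unit steps from `0` to `p`. -/
noncomputable def rank (p : Fin 2 → ℕ) : ℕ :=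
  ∑ a ∈ Finset.range (p 0), stepWeight S 0 ![a, 0] +
    ∑ b ∈ Finset.range (p 1), stepWeight S 1 ![p 0, b]

variable {S}

theorem stepWeight_le_one (i : Fin 2) (p : Fin 2 → ℕ) : stepWeight S i p ≤ 1 := by
  unfold stepWeight; split_ifs <;> simp

theorem stepWeight_eq_one {i : Fin 2} {p : Fin 2 → ℕ} :
    stepWeight S i p = 1 ↔ MeetsLine S i p := by
  unfold stepWeight; split_ifs <;> simp_all

theorem stepWeight_eq_zero {i : Fin 2} {p : Fin 2 → ℕ} :
    stepWeight S i p = 0 ↔ ¬ MeetsLine S i p := by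
  unfold stepWeight; split_ifs <;> simp_all

theorem meetsLine_of_mem {p : Fin 2 → ℕ} (hp : p ∈ S) (i : Fin 2) : MeetsLine S i p :=
  ⟨p, hp, le_rfl, rfl⟩

theorem MeetsLine.of_add {i : Fin 2} {p : Fin 2 → ℕ} {j : Fin 2} (hij : i ≠ j)
    (h : MeetsLine S i (p + unitStep j)) : MeetsLine S i p := by
  obtain ⟨s, hs, hps, hi⟩ := h
  exact ⟨s, hs, le_self_add.trans hps, by simpa [hij] using hi⟩

/-- If `p` is the last point of `S` on its line, then it belongs to `S`. -/
theorem MeetsLine.mem_of_not_add {i j : Fin 2} {p : Fin 2 → ℕ} (hij : i ≠ j)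
    (h : MeetsLine S i p) (h' : ¬ MeetsLine S i (p + unitStep j)) : p ∈ S := by
  obtain ⟨s, hs, hps, hi⟩ := h
  by_contra hp
  refine h' ⟨s, hs, fun k => ?_, by simpa [hij] using hi⟩
  have hk : p k ≤ s k := hps k
  by_cases hkj : k = j
  · subst hkj
    have : s k ≠ p k := by
      intro hsk
      apply hp
      convert hs
      funext l
      have : l = i ∨ l = k := by omega
      rcases this with rfl | rfl <;> omega
    simp
    omega
  · simpa [hkj] using hk

theorem mem_of_meetsLine {p : Fin 2 → ℕ} (hS : IsGood S) (h : ∀ i, MeetsLine S i p) :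
    p ∈ S := by
  obtain ⟨s, hs, hps, h0⟩ := h 0
  obtain ⟨t, ht, hpt, h1⟩ := h 1
  convert hS.inf_mem s hs t ht
  funext k
  have := hps k
  have := hpt k
  fin_cases k <;> simp at * <;> omega

/-- The exchange property (G3), for a point of `S` and another one on one of its lines. -/
theorem MeetsLine.exchange {i j : Fin 2} {p : Fin 2 → ℕ} (hS : IsGood S) (hij : i ≠ j)
    (hp : p ∈ S) (h : MeetsLine S i (p + unitStep j)) : MeetsLine S j (p + unitStep i) := by
  obtain ⟨s, hs, hps, hi⟩ := h
  have hi' : s i = p i := by simpa [hij] using hi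
  have hj : p j < s j := by simpa using hps j
  obtain ⟨ε, hε, h1, h2⟩ := hS.exchange p hp s hs (fun h => by rw [h] at hj; omega) i hi'.symm
  have h3 := (h2 j hij.symm).2 (by omega)
  refine ⟨ε, hε, fun k => ?_, ?_⟩
  · have : k = i ∨ k = j := by omega
    rcases this with rfl | rfl
    · simpa using h1
    · simp [hij.symm]; omega
  · simp [hij.symm]; omega

theorem meetsLine_exchange_iff {i j : Fin 2} {p : Fin 2 → ℕ} (hS : IsGood S) (hij : i ≠ j)
    (h : MeetsLine S i p) (h' : ¬ MeetsLine S i (p + unitStep j)) :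
    MeetsLine S j p ∧ ¬ MeetsLine S j (p + unitStep i) := by
  have hp := h.mem_of_not_add hij h'
  exact ⟨meetsLine_of_mem hp j, fun h => h' (h.exchange hS hij.symm hp)⟩

/-- Moving a step sideways can only lower its weight. By (G3) the weight drops in one direction
exactly if it drops in the other, so both paths around a unit square have the same weight. -/
theorem stepWeight_square (hS : IsGood S) (p : Fin 2 → ℕ) :
    stepWeight S 0 p + stepWeight S 1 (p + unitStep 0) =
      stepWeight S 1 p + stepWeight S 0 (p + unitStep 1) := by
  have h1 := @meetsLine_exchange_iff S 0 1 p hS (by decide)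
  have h2 := @meetsLine_exchange_iff S 1 0 p hS (by decide)
  have h3 := @MeetsLine.of_add S 0 p 1 (by decide)
  have h4 := @MeetsLine.of_add S 1 p 0 (by decide)
  unfold stepWeight
  split_ifs <;> simp <;> tauto

@[simp]
theorem rank_zero : rank S 0 = 0 := by simp [rank]

theorem rank_add_unitStep (hS : IsGood S) (i : Fin 2) (p : Fin 2 → ℕ) :
    rank S (p + unitStep i) = rank S p + stepWeight S i p := by
  have hp : p = ![p 0, p 1] := by funext k; fin_cases k <;> rfl
  have hrank : ∀ x y, rank S ![x, y] = ∑ a ∈ Finset.range x, stepWeight S 0 ![a, 0] +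
    ∑ b ∈ Finset.range y, stepWeight S 1 ![x, b] := fun x y => rfl
  have e0 : ∀ x y, ![x, y] + unitStep 0 = ![x + 1, y] := by
    intro x y; funext k; fin_cases k <;> simp
  have e1 : ∀ x y, ![x, y] + unitStep 1 = ![x, y + 1] := by
    intro x y; funext k; fin_cases k <;> simp
  have h1 : ∀ x y, rank S ![x, y + 1] = rank S ![x, y] + stepWeight S 1 ![x, y] := by
    intro x y
    rw [hrank, hrank, Finset.sum_range_succ, add_assoc]
  have h0 : ∀ x y, rank S ![x + 1, y] = rank S ![x, y] + stepWeight S 0 ![x, y] := by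
    intro x y
    induction y with
    | zero => simp [hrank, Finset.sum_range_succ]
    | succ y ih =>
      -- Carries the horizontal step from height `y` to height `y + 1`.
      have hsq := stepWeight_square hS ![x, y]
      rw [e0, e1] at hsq
      rw [h1, h1, ih]
      omega
  rw [hp]
  have : i = 0 ∨ i = 1 := by omega
  rcases this with rfl | rfl
  · rw [e0, h0]
  · rw [e1, h1]

theorem rank_mono (hS : IsGood S) : Monotone (rank S) :=
  monotone_of_le_add_unitStep fun p i => by rw [rank_add_unitStep hS]; omega

theorem rank_lt_rank (hS : IsGood S) {p q : Fin 2 → ℕ} (hp : p ∈ S) (hpq : p < q) :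
    rank S p < rank S q := by
  obtain ⟨hle, i, hi⟩ := Pi.lt_def.1 hpq
  have h1 : p + unitStep i ≤ q := by
    intro k
    by_cases hk : k = i
    · subst hk; simpa using hi
    · simpa [hk] using hle k
  have h2 := rank_mono hS h1
  have h3 := stepWeight_eq_one.2 (meetsLine_of_mem hp i)
  rw [rank_add_unitStep hS] at h2
  omega

/-! ### The conductor -/

/-- Each coordinate of the infimum is attained by some admissible `δ`, and `β` is the minimum of its
joins with the two vectors so obtained; (G1) concludes. -/
theorem mem_of_conductor_le (hS : IsGood S) {β : Fin 2 → ℕ}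
    (hβ : conductor (S : Set (Fin 2 → ℕ)) ≤ β) : β ∈ S := by
  set D : Set (Fin 2 → ℕ) := {δ | ∀ β, δ ≤ β → β ∈ (S : Set (Fin 2 → ℕ))} with hD
  have hne : D.Nonempty := by
    obtain ⟨δ, hδ⟩ := hS.exists_conductor
    refine ⟨δ, fun β hβ => ?_⟩
    obtain ⟨ρ, rfl⟩ := exists_add_of_le hβ
    exact hδ ρ
  have hatt : ∀ i, ∃ δ ∈ D, δ i = conductor (S : Set (Fin 2 → ℕ)) i := by
    intro i
    have h : conductor (S : Set (Fin 2 → ℕ)) i ∈ (fun δ : Fin 2 → ℕ => δ i) '' D := by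
      have : conductor (S : Set (Fin 2 → ℕ)) i = sInf ((fun δ : Fin 2 → ℕ => δ i) '' D) := by
        rw [conductor, sInf_apply, sInf_image']
      rw [this]
      exact Nat.sInf_mem (hne.image _)
    exact h
  obtain ⟨δ₀, hδ₀, h0⟩ := hatt 0
  obtain ⟨δ₁, hδ₁, h1⟩ := hatt 1
  have := hS.inf_mem _ (hδ₀ (β ⊔ δ₀) le_sup_right) _ (hδ₁ (β ⊔ δ₁) le_sup_right)
  convert this
  funext k
  have := hβ k
  fin_cases k <;> simp at * <;> omega

theorem conductor_le {E : Set (Fin 2 → ℕ)} {δ : Fin 2 → ℕ} (h : ∀ β, δ ≤ β → β ∈ E) :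
    conductor E ≤ δ := by
  intro i
  rw [conductor, sInf_apply]
  exact ciInf_le (OrderBot.bddBelow _) (⟨δ, h⟩ : {δ | ∀ β, δ ≤ β → β ∈ E})

theorem conductor_Ici (c : Fin 2 → ℕ) : conductor (Set.Ici c) = c := by
  refine le_antisymm (conductor_le fun β h => h) fun i => ?_
  rw [conductor, sInf_apply]
  have : Nonempty {δ | ∀ β, δ ≤ β → β ∈ Set.Ici c} := ⟨⟨c, fun β h => h⟩⟩
  exact le_ciInf fun δ => δ.2 _ le_rfl i

theorem conductorIdeal_eq (hS : IsGood S) :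
    conductorIdeal (S : Set (Fin 2 → ℕ)) = Set.Ici (conductor (S : Set (Fin 2 → ℕ))) := by
  ext β
  exact ⟨fun h => h.2, fun h => ⟨mem_of_conductor_le hS h, h⟩⟩

/-- With `γ = c(S) - (1, 1)`, no element of `S` has one component equal to that of `γ` and the
other one greater than that of `γ`. -/
theorem not_mem_of_add_one_eq_conductor (hS : IsGood S) {i j : Fin 2} (hij : i ≠ j)
    {s : Fin 2 → ℕ} (hi : s i + 1 = conductor (S : Set (Fin 2 → ℕ)) i)
    (hj : conductor (S : Set (Fin 2 → ℕ)) j ≤ s j) : s ∉ S := by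
  intro hs
  set c := conductor (S : Set (Fin 2 → ℕ)) with hc
  have hmem : ∀ β, c ≤ β → β ∈ S := fun β hβ => mem_of_conductor_le hS hβ
  have hk : ∀ k, k = i ∨ k = j := by omega
  -- The points `t` and `t + e i` of `S` share their `j`-th coordinate, so (G3) gives a point of `S`
  -- farther along the line of `s`: this line is unbounded in `S`.
  have hunb : ∀ n, ∃ t ∈ S, t i = s i ∧ c j ≤ t j ∧ n ≤ t j := by
    intro n
    induction n with
    | zero => exact ⟨s, hs, rfl, hj, Nat.zero_le _⟩
    | succ n ih =>
      obtain ⟨t, ht, h1, h2, h3⟩ := ih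
      have hc' : t + unitStep i ∈ S := by
        refine hmem _ fun k => ?_
        rcases hk k with rfl | rfl
        · simp; omega
        · simp [hij.symm]; omega
      have := MeetsLine.exchange (i := j) (j := i) hS hij.symm ht (meetsLine_of_mem hc' j)
      obtain ⟨u, hu, htu, hui⟩ := this
      have h4 := htu j
      simp [hij] at h4 hui
      exact ⟨u, hu, by omega, by omega, by omega⟩
  -- By (G1) the line then lies in `S` from height `c j` on, so the `i`-th coordinate of the
  -- conductor could be lowered by one.
  have hle : c ≤ Function.update c i (s i) := by
    refine conductor_le fun β hβ => ?_
    have hβi := hβ i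
    have hβj := hβ j
    simp [hij.symm] at hβi hβj
    rcases hβi.eq_or_lt with h | h
    · obtain ⟨t, ht, h1, h2, h3⟩ := hunb (β j)
      have hβ' : β + unitStep i ∈ S := by
        refine hmem _ fun k => ?_
        rcases hk k with rfl | rfl
        · simp; omega
        · simp [hij.symm]; omega
      change β ∈ S
      convert hS.inf_mem _ ht _ hβ'
      funext k
      rcases hk k with rfl | rfl
      · simp; omega
      · simp [hij.symm]; omega
    · refine hmem _ fun k => ?_
      rcases hk k with rfl | rfl
      · exact hi.ge.trans h
      · exact hβj
  have := hle i
  simp at this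
  omega

/-! ### The excess of the canonical ideal over `S` -/

variable (S) in
/-- The distance between the canonical ideal `K` of `S` and `S`, counted on a path from `0` to `p`:
the step from `p` to `p + e i` counts for `K` exactly if the opposite step from
`c(S) - p - e i` to `c(S) - p` does not count for `S`. -/
noncomputable def excess (p : Fin 2 → ℕ) : ℤ :=
  p 0 + p 1 - rank S (conductor (S : Set (Fin 2 → ℕ))) +
    rank S (conductor (S : Set (Fin 2 → ℕ)) - p) - rank S p

theorem excess_zero : excess S 0 = 0 := by simp [excess]

theorem excess_conductor : excess S (conductor (S : Set (Fin 2 → ℕ))) =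
    conductor (S : Set (Fin 2 → ℕ)) 0 + conductor (S : Set (Fin 2 → ℕ)) 1 -
      2 * rank S (conductor (S : Set (Fin 2 → ℕ))) := by
  simp [excess]; ring

theorem excess_add_unitStep_of_lt (hS : IsGood S) {i : Fin 2} {p : Fin 2 → ℕ}
    (h : p i < conductor (S : Set (Fin 2 → ℕ)) i) :
    excess S (p + unitStep i) = excess S p + 1 - stepWeight S i p -
      stepWeight S i (conductor (S : Set (Fin 2 → ℕ)) - (p + unitStep i)) := by
  set c := conductor (S : Set (Fin 2 → ℕ)) with hc
  have hcp : c - p = c - (p + unitStep i) + unitStep i := by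
    funext k
    by_cases hk : k = i
    · subst hk; simp; omega
    · simp [hk]
  have hsum : (p + unitStep i) 0 + (p + unitStep i) 1 = p 0 + p 1 + 1 := by
    fin_cases i <;> simp <;> omega
  zify at hsum
  unfold excess
  rw [← hc, hcp, rank_add_unitStep hS, rank_add_unitStep hS]
  push_cast
  linarith

/-- Past `c i`, the truncated difference `c - p` no longer changes in direction `i`, so the step
always counts for the canonical ideal. -/
theorem excess_add_unitStep_of_le (hS : IsGood S) {i : Fin 2} {p : Fin 2 → ℕ}
    (h : conductor (S : Set (Fin 2 → ℕ)) i ≤ p i) :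
    excess S (p + unitStep i) = excess S p + 1 - stepWeight S i p := by
  set c := conductor (S : Set (Fin 2 → ℕ)) with hc
  have hcp : c - (p + unitStep i) = c - p := by
    funext k
    by_cases hk : k = i
    · subst hk; simp; omega
    · simp [hk]
  have hsum : (p + unitStep i) 0 + (p + unitStep i) 1 = p 0 + p 1 + 1 := by
    fin_cases i <;> simp <;> omega
  zify at hsum
  unfold excess
  rw [← hc, hcp, rank_add_unitStep hS]
  push_cast
  linarith

/-- A step and its opposite cannot both count for `S`: the sum of the two witnesses would have
`i`-th coordinate `c i - 1` and the other one at least that of `c`. -/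
theorem excess_mono (hS : IsGood S) : Monotone (excess S) := by
  refine monotone_of_le_add_unitStep fun p i => ?_
  have h1 := stepWeight_le_one (S := S) i p
  rcases lt_or_ge (p i) (conductor (S : Set (Fin 2 → ℕ)) i) with h | h
  · rw [excess_add_unitStep_of_lt hS h]
    set c := conductor (S : Set (Fin 2 → ℕ)) with hc
    have h2 := stepWeight_le_one (S := S) i (c - (p + unitStep i))
    have : ¬ (stepWeight S i p = 1 ∧ stepWeight S i (c - (p + unitStep i)) = 1) := by
      rw [stepWeight_eq_one, stepWeight_eq_one]
      rintro ⟨⟨s, hs, hps, hsi⟩, ⟨t, ht, hpt, hti⟩⟩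
      obtain ⟨j, hij⟩ : ∃ j, i ≠ j := (exists_ne i).imp fun _ h => h.symm
      have hpsj : p j ≤ s j := hps j
      have hptj := hpt j
      simp [hij.symm] at hptj hti
      refine not_mem_of_add_one_eq_conductor hS hij (s := s + t) ?_ ?_ (S.add_mem hs ht)
      · rw [← hc]; simp; omega
      · rw [← hc]; simp; omega
    omega
  · rw [excess_add_unitStep_of_le hS h]
    omega

/-- Above `c` every step counts for `S`, so the excess is constant there; compare `p` with `c + p`.
-/
theorem excess_le_excess_conductor (hS : IsGood S) (p : Fin 2 → ℕ) :
    excess S p ≤ excess S (conductor (S : Set (Fin 2 → ℕ))) := by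
  set c := conductor (S : Set (Fin 2 → ℕ)) with hc
  have h : Monotone fun q => -excess S (c + q) := by
    refine monotone_of_le_add_unitStep fun q i => ?_
    have hq : stepWeight S i (c + q) = 1 :=
      stepWeight_eq_one.2 (meetsLine_of_mem (mem_of_conductor_le hS le_self_add) i)
    rw [← add_assoc, excess_add_unitStep_of_le hS (by rw [← hc]; simp), hq]
    simp
  have h1 := h (zero_le (a := p))
  have h2 := excess_mono hS (le_add_self : p ≤ c + p)
  simp only [add_zero] at h1
  linarith

/-! ### The levels of the set of pseudo-Frobenius elements -/

/-- As `α ∉ S`, one of its two lines misses `S`. The opposite line misses `S` as well: adding `α` to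
a nonzero point of it would give a forbidden element of `S`. -/
theorem exists_excess_lt (hS : IsGood S) {α : Fin 2 → ℕ}
    (hα : α ∈ remaining (pseudoFrobenius S) 1) :
    ∃ i, excess S α < excess S (α + unitStep i) := by
  have hPF : α ∈ pseudoFrobenius S := hα.1
  obtain ⟨i, hi⟩ : ∃ i, ¬ MeetsLine S i α := by
    by_contra! h
    exact hPF.1 (mem_of_meetsLine hS h)
  refine ⟨i, ?_⟩
  rw [← stepWeight_eq_zero] at hi
  rcases lt_or_ge (α i) (conductor (S : Set (Fin 2 → ℕ)) i) with h | h
  · rw [excess_add_unitStep_of_lt hS h, hi]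
    set c := conductor (S : Set (Fin 2 → ℕ)) with hc
    have : stepWeight S i (c - (α + unitStep i)) = 0 := by
      rw [stepWeight_eq_zero]
      rintro ⟨s, hs, hps, hsi⟩
      obtain ⟨j, hij⟩ : ∃ j, i ≠ j := (exists_ne i).imp fun _ h => h.symm
      have hpsj := hps j
      simp [hij.symm] at hpsj hsi
      -- For `s = 0` the pseudo-Frobenius property says nothing; here `α i = c i - 1` and `c j ≤ α
      -- j`, and such elements disappear with the top level.
      by_cases hs0 : s = 0
      · subst hs0
        have := strip_step (A := pseudoFrobenius S) (c := c)
          (fun β hβ hmem => hmem.1 (mem_of_conductor_le hS hβ)) i j (by omega) 1 α hα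
          (by simpa using hpsj)
        simp at hsi
        omega
      · refine not_mem_of_add_one_eq_conductor hS hij (s := α + s) ?_ ?_ (hPF.2 s hs hs0)
        · rw [← hc]; simp; omega
        · rw [← hc]; simp; omega
    rw [this]
    simp
  · rw [excess_add_unitStep_of_le hS h, hi]
    simp

/-- For an element that survives the removal of the top level and for each `i`, there is a greater
element whose `i`-th component is strictly greater. -/
theorem exists_above_of_mem_remaining_succ {A : Set (Fin 2 → ℕ)} {n : ℕ} {α : Fin 2 → ℕ}
    (hα : α ∈ remaining A (n + 1)) (i : Fin 2) :
    ∃ β ∈ remaining A n, α + unitStep i ≤ β := by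
  obtain ⟨hα, hnot⟩ := hα
  by_cases hmax : α ∈ maximals (remaining A n)
  · have : ∃ β₁ ∈ maximals (remaining A n) \ {α}, ∃ β₂ ∈ maximals (remaining A n) \ {α},
        α = β₁ ⊓ β₂ := by
      by_contra h
      exact hnot ⟨hmax, h⟩
    obtain ⟨β₁, ⟨⟨h1, -⟩, hne1⟩, β₂, ⟨⟨h2, -⟩, hne2⟩, hmin⟩ := this
    have step : ∀ β : Fin 2 → ℕ, α ≤ β → α i < β i → α + unitStep i ≤ β := by
      intro β hβ hi k
      by_cases hk : k = i
      · subst hk; simpa using hi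
      · simpa [hk] using hβ k
    have hle1 : α ≤ β₁ := hmin ▸ inf_le_left
    have hle2 : α ≤ β₂ := hmin ▸ inf_le_right
    by_cases hi1 : α i < β₁ i
    · exact ⟨β₁, h1, step _ hle1 hi1⟩
    by_cases hi2 : α i < β₂ i
    · exact ⟨β₂, h2, step _ hle2 hi2⟩
    -- Otherwise both elements agree with `α` in coordinate `i`, and the one with the smaller `j`-th
    -- coordinate is `α` itself.
    exfalso
    obtain ⟨j, hij⟩ : ∃ j, i ≠ j := (exists_ne i).imp fun _ h => h.symm
    have hk : ∀ k, k = i ∨ k = j := by omega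
    have hj : α j = min (β₁ j) (β₂ j) := congrFun hmin j
    have a1 : α i ≤ β₁ i := hle1 i
    have a2 : α i ≤ β₂ i := hle2 i
    rcases le_total (β₁ j) (β₂ j) with h | h
    · apply hne1
      funext k
      rcases hk k with rfl | rfl <;> omega
    · apply hne2
      funext k
      rcases hk k with rfl | rfl <;> omega
  · have : ∃ β ∈ remaining A n, StrongLT α β := by
      by_contra! h
      exact hmax ⟨hα, h⟩
    obtain ⟨β, hβ, hlt⟩ := this
    refine ⟨β, hβ, fun k => ?_⟩
    have := hlt k
    by_cases hk : k = i
    · subst hk; simpa using this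
    · simpa [hk] using this.le

theorem remaining_subset {A : Set (Fin 2 → ℕ)} {m n : ℕ} (h : m ≤ n) :
    remaining A n ⊆ remaining A m :=
  antitone_nat_of_succ_le (f := remaining A) (fun _ => Set.sdiff_subset) h

/-- The direction `i` in which the excess grows depends on `α`; it matters that an element of the
previous remainder exists beyond `α + e i` for either `i`. -/
theorem excess_add_le_of_mem_remaining (hS : IsGood S) (n : ℕ) :
    ∀ α ∈ remaining (pseudoFrobenius S) (n + 1),
      excess S α + (n + 1) ≤ excess S (conductor (S : Set (Fin 2 → ℕ))) := by
  induction n with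
  | zero =>
    intro α hα
    obtain ⟨i, hi⟩ := exists_excess_lt hS hα
    have := excess_le_excess_conductor hS (α + unitStep i)
    push_cast
    linarith
  | succ n ih =>
    intro α hα
    obtain ⟨i, hi⟩ := exists_excess_lt hS (remaining_subset (by omega) hα)
    obtain ⟨β, hβ, hle⟩ := exists_above_of_mem_remaining_succ hα i
    have h1 := ih β hβ
    have h2 := excess_mono hS hle
    push_cast
    linarith

theorem type_le (hS : IsGood S) :
    (type S : ℤ) ≤ excess S (conductor (S : Set (Fin 2 → ℕ))) + 1 := by
  have h0 : 0 ≤ excess S (conductor (S : Set (Fin 2 → ℕ))) := by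
    have := excess_mono hS (zero_le (a := conductor (S : Set (Fin 2 → ℕ))))
    rwa [excess_zero] at this
  obtain ⟨n, hn⟩ := Int.eq_ofNat_of_zero_le h0
  have hempty : remaining (pseudoFrobenius S) (n + 1) = ∅ := by
    rw [Set.eq_empty_iff_forall_notMem]
    intro α hα
    have h1 := excess_add_le_of_mem_remaining hS n α hα
    have h2 := excess_mono hS (zero_le (a := α))
    rw [excess_zero] at h2
    omega
  have : type S ≤ n + 1 := Nat.sInf_le hempty
  omega

/-! ### Lengths of chains -/

/-- The rank increases strictly along chains in `S`. Only this inequality is needed, so the equality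
of lengths of saturated chains plays no role. -/
theorem chainDist_le_rank (hS : IsGood S) (β : Fin 2 → ℕ) :
    chainDist (S : Set (Fin 2 → ℕ)) 0 β ≤ rank S β := by
  rcases Set.eq_empty_or_nonempty {n | HasSaturatedChain (S : Set (Fin 2 → ℕ)) 0 β n} with h | h
  -- Without any saturated chain the infimum takes its default value `0`.
  · simp [chainDist, h]
  · obtain ⟨a, h0, hβ, hmem, hlt⟩ := Nat.sInf_mem h
    change a (chainDist (S : Set (Fin 2 → ℕ)) 0 β) = β at hβ
    change ∀ k ≤ chainDist (S : Set (Fin 2 → ℕ)) 0 β, _ at hmem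
    change ∀ k < chainDist (S : Set (Fin 2 → ℕ)) 0 β, _ at hlt
    have : ∀ k ≤ chainDist (S : Set (Fin 2 → ℕ)) 0 β, k ≤ rank S (a k) := by
      intro k
      induction k with
      | zero => simp
      | succ k ih =>
        intro hk
        have h1 := ih (by omega)
        have h2 := rank_lt_rank hS (hmem k (by omega)) (hlt k hk).1
        omega
    exact (this _ le_rfl).trans_eq (by rw [hβ])

theorem hasSaturatedChain_univ (β : Fin 2 → ℕ) :
    HasSaturatedChain Set.univ 0 β (β 0 + β 1) := by
  -- The path runs along the first axis up to `β 0`, then vertically.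
  refine ⟨fun k => ![min k (β 0), k - β 0], ?_, ?_, fun _ _ => trivial, fun k hk => ?_⟩
  · funext l; fin_cases l <;> simp
  · funext l; fin_cases l <;> simp
  · refine ⟨Pi.lt_def.2 ⟨fun l => ?_, ?_⟩, ?_⟩
    · fin_cases l <;> simp <;> omega
    · by_cases h : k < β 0
      · exact ⟨0, by simp; omega⟩
      · exact ⟨1, by simp; omega⟩
    · rintro γ - ⟨h1, h2⟩
      obtain ⟨h1, i, hi⟩ := Pi.lt_def.1 h1
      obtain ⟨h2, j, hj⟩ := Pi.lt_def.1 h2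
      have a0 := h1 0
      have a1 := h1 1
      have b0 := h2 0
      have b1 := h2 1
      fin_cases i <;> fin_cases j <;> simp at * <;> omega

theorem chainDist_univ (β : Fin 2 → ℕ) : chainDist Set.univ 0 β = β 0 + β 1 := by
  have hne : {n | HasSaturatedChain Set.univ 0 β n}.Nonempty := ⟨_, hasSaturatedChain_univ β⟩
  obtain ⟨a, h0, hβ, -, hlt⟩ := Nat.sInf_mem hne
  change a (chainDist Set.univ 0 β) = β at hβ
  have : ∀ k ≤ chainDist Set.univ 0 β, a k 0 + a k 1 ≤ k := by
    intro k
    induction k with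
    | zero => simp [h0]
    | succ k ih =>
      intro hk
      have h1 := ih (by omega)
      obtain ⟨h2, h3⟩ := hlt k hk
      obtain ⟨hle, i, hi⟩ := Pi.lt_def.1 h2
      have hstep : a k + unitStep i ≤ a (k + 1) := by
        intro l
        by_cases hl : l = i
        · subst hl; simpa using hi
        · simpa [hl] using hle l
      have heq : a k + unitStep i = a (k + 1) := by
        by_contra hne
        refine h3 _ trivial ⟨Pi.lt_def.2 ⟨le_self_add, i, by simp⟩, lt_of_le_of_ne hstep hne⟩
      rw [← heq]
      fin_cases i <;> simp <;> omega
  have h1 := this _ le_rfl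
  rw [hβ] at h1
  exact le_antisymm (Nat.sInf_le (hasSaturatedChain_univ β)) h1

theorem sInf_eq_zero_of_mem {E : Set (Fin 2 → ℕ)} (h : 0 ∈ E) : sInf E = 0 := by
  funext i
  rw [sInf_apply]
  exact Nat.le_zero.1 (ciInf_le (OrderBot.bddBelow _) (⟨0, h⟩ : E))

/-- With `d` the distance from `0` to `c` in `S`, the difference `g(S) - l(S)` is `c 0 + c 1 - 2 *
d` plus a nonnegative distance in the conductor ideal, and `d ≤ rank S c`. -/
theorem excess_conductor_le (hS : IsGood S) :
    excess S (conductor (S : Set (Fin 2 → ℕ))) ≤ genus S - length S := by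
  have h1 := chainDist_le_rank hS (conductor (S : Set (Fin 2 → ℕ)))
  rw [excess_conductor, genus, length, idealDist, idealDist,
    sInf_eq_zero_of_mem (Set.mem_univ 0), sInf_eq_zero_of_mem S.zero_mem, conductorIdeal_eq hS,
    conductor_Ici, chainDist_univ]
  push_cast
  omega

end GoodSemigroup

theorem mainTheorem2 (S : AddSubmonoid (Fin 2 → ℕ)) (hS : GoodSemigroup.IsGood S)
    (hloc : GoodSemigroup.IsLocal S) :
    GoodSemigroup.genus S ≥ (GoodSemigroup.type S : ℤ) + GoodSemigroup.length S - 1 := by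
  have h1 := GoodSemigroup.type_le hS
  have h2 := GoodSemigroup.excess_conductor_le hS
  linarith
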